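/- Let $K\ge 1$, let $\Theta\subseteq\mathbb{R}^d$ be an arbitrary nonempty set, and for each $\theta\in\Theta$ let $p_\theta$ be a probability density with respect to counting measure on $\{1,\dots,K\}$ (that is, $p_\theta(k)\ge 0$ and $\sum_{k=1}^K p_\theta(k)=1$), measurable in $\theta$. Let $\mathcal G$ be the set of all probability measures on $\Theta$, and for $g\in\mathcal G$ put $f_g(k)=\int_\Theta p_\theta(k)\,\mathrm{d}g(\theta)$. Fix $g_0\in\mathcal G$ such that $f_{g_0}(k)>0$ for every $k\in\{1,\dots,K\}$, and let $X_1,X_2,\dots$ be i.i.d. with density $f_{g_0}$. Write $\ell_n(f)=\sum_{i=1}^n\log f(X_i)\in[-\infty,0]$ (with $\log 0=-\infty$), $$\chi^2(f,f_{g_0})=\sum_{k=1}^K\Big(\frac{f(k)}{f_{g_0}(k)}-1\Big)^2 f_{g_0}(k),$$ and, for $c\in\mathbb{R}$, let $\mathcal G_n(c)$ be the set of all $g\in\mathcal G$ with $\ell_n(f_g)\ge \ell_n(f_{g_0})+c$, together with all maximizers $\hat g$ of $g\mapsto\ell_n(f_g)$ over $\mathcal G$ (nonparametric maximum likelihood estimators),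 if there are any. Finally let $$L_n(\mathcal G,g_0)=2\Big\{\sup_{g\in\mathcal G}\ell_n(f_g)-\ell_n(f_{g_0})\Big\},$$ which equals $2\{\ell_n(f_{\hat g})-\ell_n(f_{g_0})\}$ whenever a maximizer $\hat g$ exists. Then, for every $c<0$, $$\sup_{g\in\mathcal G_n(c)} n\,\chi^2(f_g,f_{g_0})=O_{\mathbb P}(1).$$ Moreover, $L_n(\mathcal G,g_0)$ is finite, and it converges in distribution, as $n\to\infty$, to a tight limit (a Borel probability measure on $\mathbb{R}$). -/

import Mathlib

open MeasureTheory ProbabilityTheory Filter Topology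

/-- The mixture density `f_g(k) = ∫ p_θ(k) dg(θ)`, for component densities `p θ` with respect to
counting measure on a `K`-point sample space, indexed by `θ` in a set `Θ`, and a mixing
distribution `g`, i.e. a probability measure on `Θ`. -/
noncomputable def mixtureDensity {d K : ℕ} {Θ : Set (EuclideanSpace ℝ (Fin d))}
    (p : Θ → Fin K → ℝ) (g : ProbabilityMeasure Θ) (k : Fin K) : ℝ :=
  ∫ θ, p θ k ∂(g : Measure Θ)

/-- The log-likelihood `ℓ_n(f) = ∑ log f(x_i)` of the first `n` observations of the sequence `x`.
It is extended-real valued, with `log 0 = -∞`. -/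
noncomputable def logLikelihood {K : ℕ} (n : ℕ) (x : ℕ → Fin K) (f : Fin K → ℝ) : EReal :=
  ∑ i ∈ Finset.range n, ENNReal.log (ENNReal.ofReal (f (x i)))

/-- `g` is a nonparametric maximum likelihood estimator of the mixing distribution. -/
def IsNPMLE {d K : ℕ} {Θ : Set (EuclideanSpace ℝ (Fin d))} (p : Θ → Fin K → ℝ)
    (n : ℕ) (x : ℕ → Fin K) (g : ProbabilityMeasure Θ) : Prop :=
  ∀ g' : ProbabilityMeasure Θ,
    logLikelihood n x (mixtureDensity p g') ≤ logLikelihood n x (mixtureDensity p g)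

/-- The class `𝒢_n(c)` of mixing distributions `g` with `ℓ_n(f_g) ≥ ℓ_n(f_{g₀}) + c`, together
with all exact NPMLEs. -/
def approxMLESet {d K : ℕ} {Θ : Set (EuclideanSpace ℝ (Fin d))} (p : Θ → Fin K → ℝ)
    (g₀ : ProbabilityMeasure Θ) (n : ℕ) (x : ℕ → Fin K) (c : ℝ) :
    Set (ProbabilityMeasure Θ) :=
  {g | logLikelihood n x (mixtureDensity p g₀) + (c : EReal)
      ≤ logLikelihood n x (mixtureDensity p g)} ∪ {g | IsNPMLE p n x g}

/-- The chi-square divergence `χ²(f, f₀) = ‖f / f₀ - 1‖²` in `L₂(f₀ dμ)`, with `μ` the counting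
measure on a `K`-point space. It is used for `f₀` everywhere positive. -/
noncomputable def chiSqDiv {K : ℕ} (f f₀ : Fin K → ℝ) : ℝ :=
  ∑ k, (f k / f₀ k - 1) ^ 2 * f₀ k

/-- The likelihood ratio statistic `L_n(𝒢, g₀) = 2 {sup_g ℓ_n(f_g) - ℓ_n(f_{g₀})}`. -/
noncomputable def likelihoodRatioStat {d K : ℕ} {Θ : Set (EuclideanSpace ℝ (Fin d))}
    (p : Θ → Fin K → ℝ) (g₀ : ProbabilityMeasure Θ) (n : ℕ) (x : ℕ → Fin K) : EReal :=
  2 * ((⨆ g : ProbabilityMeasure Θ, logLikelihood n x (mixtureDensity p g))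
    - logLikelihood n x (mixtureDensity p g₀))

/-- Whenever an NPMLE exists, `L_n` is obtained by plugging it into the log-likelihood. -/
theorem likelihoodRatioStat_eq_of_isNPMLE {d K : ℕ} {Θ : Set (EuclideanSpace ℝ (Fin d))}
    (p : Θ → Fin K → ℝ) (g₀ ghat : ProbabilityMeasure Θ) (n : ℕ) (x : ℕ → Fin K)
    (h : IsNPMLE p n x ghat) :
    likelihoodRatioStat p g₀ n x =
      2 * (logLikelihood n x (mixtureDensity p ghat)
        - logLikelihood n x (mixtureDensity p g₀)) := by
  have hs : (⨆ g : ProbabilityMeasure Θ, logLikelihood n x (mixtureDensity p g))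
      = logLikelihood n x (mixtureDensity p ghat) :=
    le_antisymm (iSup_le h)
      (le_iSup (fun g => logLikelihood n x (mixtureDensity p g)) ghat)
  rw [likelihoodRatioStat, hs]

/-- `Y_n = O_ℙ(1)` for a sequence of `[0, ∞]`-valued functions on a probability space. -/
def IsBoundedInProbability {Ω : Type*} [MeasurableSpace Ω] (P : Measure Ω)
    (Y : ℕ → Ω → ENNReal) : Prop :=
  ∀ ε : ℝ, 0 < ε → ∃ M : ℝ, ∀ n : ℕ,
    P {ω | ENNReal.ofReal M < Y n ω} ≤ ENNReal.ofReal ε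

/-! The sample space is finite, so the data enter only through n and the vector z = n^{-1/2} ∑
(e_{X_i} - w), where w = f_{g₀}. By the central limit theorem z has a Gaussian limit, hence is
tight. On ‖z‖ ≤ M the rest is deterministic. Put u = √n (f_g / w - 1), so that ∑ w u² = n χ².

Localization (`mul_sum_sq_le_of_le_sum_log`): all ratios f_g / w share an upper bound A, and on (0,
A] the logarithm lies below y - 1 minus a multiple of (y - 1)². A log-likelihood ratio of at least c
therefore forces ∑ w u² to be bounded, which is the first claim.

Expansion (`two_mul_sum_log_sub_quad_le`): for bounded u, twice the log-likelihood ratio is 2⟨z, u⟩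
- ∑ w u² up to O(n^{-1/2}). So L_n is close to the supremum of this quadratic over the attainable u.
Mixtures form a convex set, so these sets of u increase with n, and Dini's theorem replaces them by
their union, uniformly for bounded z (`exists_forall_quadSup_iUnion_le`). The resulting supremum is
a continuous function of z; continuous mapping and Slutsky's lemma give the limit law. -/

/-! ### Elementary inequalities for the logarithm -/

/-- A quadratic upper bound for `log y` around `y = 1`, valid on `(0, A]`. -/
theorem log_le_sub_one_sub_sq {y A : ℝ} (hy : 0 < y) (hyA : y ≤ A) :
    Real.log y ≤ (y - 1) - ((√A + 1) ^ 2)⁻¹ * (y - 1) ^ 2 := by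
  have hs : 0 < √y := Real.sqrt_pos.2 hy
  have hsq : √y ^ 2 = y := Real.sq_sqrt hy.le
  -- The quadratic gain comes from 2(√y - 1) = (y - 1) - (√y - 1)².
  have hlog : Real.log y = 2 * Real.log √y := by
    rw [Real.log_sqrt hy.le]; ring
  have h1 : Real.log √y ≤ √y - 1 := Real.log_le_sub_one_of_pos hs
  have h2 : ((√A + 1) ^ 2)⁻¹ * (y - 1) ^ 2 ≤ (√y - 1) ^ 2 := by
    have hle : √y ≤ √A := Real.sqrt_le_sqrt hyA
    have hA : 0 < (√A + 1) ^ 2 := by positivity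
    rw [inv_mul_le_iff₀ hA]
    have : (y - 1) ^ 2 = (√y + 1) ^ 2 * (√y - 1) ^ 2 := by rw [← hsq]; simp; ring
    rw [this]
    gcongr
  nlinarith

/-- The second-order expansion of `log (1 + h)` with a cubic remainder. -/
theorem abs_log_one_add_sub_le {h : ℝ} (hh : |h| ≤ 1 / 2) :
    |Real.log (1 + h) - (h - h ^ 2 / 2)| ≤ 2 * |h| ^ 3 := by
  have h1 : |(-h)| < 1 := by rw [abs_neg]; linarith
  have key := Real.abs_log_sub_add_sum_range_le h1 2
  simp only [Finset.sum_range_succ, Finset.sum_range_zero, abs_neg] at key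
  have e : (0 + (-h) ^ (0 + 1) / ((0 : ℕ) + 1 : ℝ) + (-h) ^ (1 + 1) / ((1 : ℕ) + 1 : ℝ)
      + Real.log (1 - -h)) = Real.log (1 + h) - (h - h ^ 2 / 2) := by
    norm_num; ring
  rw [e] at key
  refine key.trans ?_
  rw [div_le_iff₀ (by linarith)]
  have h2 := mul_nonneg (pow_nonneg (abs_nonneg h) 3) (show 0 ≤ 1 - 2 * |h| by linarith)
  have h3 : 2 * |h| ^ 3 * (1 - |h|) - |h| ^ (2 + 1) = |h| ^ 3 * (1 - 2 * |h|) := by ring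
  linarith

/-- Weighted Young inequality. -/
theorem sum_mul_le_young {ι : Type*} [Fintype ι] {w : ι → ℝ} (hw : ∀ k, 0 < w k) {δ : ℝ}
    (hδ : 0 < δ) (z u : ι → ℝ) :
    ∑ k, z k * u k ≤ δ * ∑ k, w k * u k ^ 2 + (4 * δ)⁻¹ * ∑ k, z k ^ 2 / w k := by
  rw [Finset.mul_sum, Finset.mul_sum, ← Finset.sum_add_distrib]
  refine Finset.sum_le_sum fun k _ => ?_
  have := hw k
  have e : δ * (w k * u k ^ 2) + (4 * δ)⁻¹ * (z k ^ 2 / w k) - z k * u k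
      = (2 * δ * w k * u k - z k) ^ 2 / (4 * δ * w k) := by
    field_simp; ring
  have : 0 ≤ (2 * δ * w k * u k - z k) ^ 2 / (4 * δ * w k) := by positivity
  linarith

/-- Each summand is at most R; summing the coordinate bounds gives a constant independent of k
without choosing a smallest weight. -/
theorem abs_le_sum_sqrt {ι : Type*} [Fintype ι] {w : ι → ℝ} (hw : ∀ k, 0 < w k) {R : ℝ}
    {u : ι → ℝ} (hu : ∑ k, w k * u k ^ 2 ≤ R) (k : ι) : |u k| ≤ ∑ j, √(R / w j) := by
  have h1 : w k * u k ^ 2 ≤ R :=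
    (Finset.single_le_sum (f := fun k => w k * u k ^ 2)
      (fun j _ => mul_nonneg (hw j).le (sq_nonneg _)) (Finset.mem_univ k)).trans hu
  have h2 : |u k| ≤ √(R / w k) := by
    apply Real.abs_le_sqrt
    rw [le_div_iff₀ (hw k)]; linarith
  exact h2.trans (Finset.single_le_sum (f := fun j => √(R / w j))
    (fun j _ => Real.sqrt_nonneg _) (Finset.mem_univ k))

/-! ### Suprema of concave quadratic functions -/

/-- The supremum over `u ∈ S` of the quadratic function `2 ⟨z, u⟩ - ∑ w u²`. -/
noncomputable def quadSup {K : ℕ} (w : Fin K → ℝ) (S : Set (Fin K → ℝ))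
    (z : EuclideanSpace ℝ (Fin K)) : ℝ :=
  ⨆ u : S, (2 * ∑ k, z k * u.1 k - ∑ k, w k * u.1 k ^ 2)

section quadSup

variable {K : ℕ} {w : Fin K → ℝ} {S T : Set (Fin K → ℝ)}

theorem bddAbove_range_quad (hw : ∀ k, 0 < w k) (S : Set (Fin K → ℝ))
    (z : EuclideanSpace ℝ (Fin K)) :
    BddAbove (Set.range fun u : S => 2 * ∑ k, z k * u.1 k - ∑ k, w k * u.1 k ^ 2) := by
  refine ⟨∑ k, z k ^ 2 / w k, ?_⟩
  rintro _ ⟨u, rfl⟩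
  have := sum_mul_le_young hw (δ := 1 / 2) (by norm_num) z u.1
  norm_num at this
  simp only
  linarith

theorem le_quadSup (hw : ∀ k, 0 < w k) {u : Fin K → ℝ} (hu : u ∈ S)
    (z : EuclideanSpace ℝ (Fin K)) :
    2 * ∑ k, z k * u k - ∑ k, w k * u k ^ 2 ≤ quadSup w S z :=
  le_ciSup (bddAbove_range_quad hw S z) ⟨u, hu⟩

theorem quadSup_le (hS : S.Nonempty) {z : EuclideanSpace ℝ (Fin K)} {B : ℝ}
    (h : ∀ u ∈ S, 2 * ∑ k, z k * u k - ∑ k, w k * u k ^ 2 ≤ B) : quadSup w S z ≤ B :=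
  haveI := hS.to_subtype
  ciSup_le fun u => h u.1 u.2

theorem quadSup_mono (hw : ∀ k, 0 < w k) (hS : S.Nonempty) (hST : S ⊆ T)
    (z : EuclideanSpace ℝ (Fin K)) : quadSup w S z ≤ quadSup w T z :=
  quadSup_le hS fun _ hu => le_quadSup hw (hST hu) z

theorem quadSup_nonneg (hw : ∀ k, 0 < w k) (h0 : (0 : Fin K → ℝ) ∈ S)
    (z : EuclideanSpace ℝ (Fin K)) : 0 ≤ quadSup w S z := by
  simpa using le_quadSup hw h0 z

/-- A finite supremum of functions affine in z is convex, and a finite convex function on a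
finite-dimensional space is continuous. -/
theorem continuous_quadSup (hw : ∀ k, 0 < w k) (hS : S.Nonempty) :
    Continuous (quadSup w S) := by
  have hc : ConvexOn ℝ Set.univ (quadSup w S) := by
    refine ⟨convex_univ, fun x _ y _ a b ha hb hab => quadSup_le hS fun u hu => ?_⟩
    have hx := mul_le_mul_of_nonneg_left (le_quadSup hw hu x) ha
    have hy := mul_le_mul_of_nonneg_left (le_quadSup hw hu y) hb
    have e : ∑ k, (a • x + b • y) k * u k = a * ∑ k, x k * u k + b * ∑ k, y k * u k := by
      rw [Finset.mul_sum, Finset.mul_sum, ← Finset.sum_add_distrib]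
      exact Finset.sum_congr rfl fun k _ => by simp; ring
    rw [e, smul_eq_mul, smul_eq_mul]
    have hb' : b = 1 - a := by linarith
    subst hb'
    linarith
  exact continuousOn_univ.1 (hc.continuousOn isOpen_univ)

theorem tendsto_quadSup_iUnion (hw : ∀ k, 0 < w k) {S : ℕ → Set (Fin K → ℝ)}
    (hS : ∀ n, (S n).Nonempty) (hmono : Monotone S) (z : EuclideanSpace ℝ (Fin K)) :
    Tendsto (fun n => quadSup w (S n) z) atTop (𝓝 (quadSup w (⋃ n, S n) z)) := by
  have hm : Monotone fun n => quadSup w (S n) z :=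
    fun m n hmn => quadSup_mono hw (hS m) (hmono hmn) z
  refine tendsto_atTop_isLUB hm ⟨?_, fun B hB => ?_⟩
  · rintro _ ⟨n, rfl⟩
    exact quadSup_mono hw (hS n) (Set.subset_iUnion S n) z
  · refine quadSup_le ((hS 0).mono (Set.subset_iUnion S 0)) fun u hu => ?_
    obtain ⟨n, hn⟩ := Set.mem_iUnion.1 hu
    exact (le_quadSup hw hn z).trans (hB ⟨n, rfl⟩)

/-- Dini's theorem: continuous functions increasing pointwise to a continuous limit converge
uniformly on compacts. -/
theorem exists_forall_quadSup_iUnion_le (hw : ∀ k, 0 < w k) {S : ℕ → Set (Fin K → ℝ)}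
    (hS : ∀ n, (S n).Nonempty) (hmono : Monotone S) {C : Set (EuclideanSpace ℝ (Fin K))}
    (hC : IsCompact C) {ε : ℝ} (hε : 0 < ε) :
    ∃ n₀, ∀ n ≥ n₀, ∀ z ∈ C, quadSup w (⋃ n, S n) z ≤ quadSup w (S n) z + ε := by
  have h := Monotone.tendstoUniformlyOn_of_forall_tendsto hC
    (F := fun n => quadSup w (S n)) (f := quadSup w (⋃ n, S n))
    (fun n => (continuous_quadSup hw (hS n)).continuousOn)
    (fun z _ m n hmn => quadSup_mono hw (hS m) (hmono hmn) z)
    (continuous_quadSup hw ((hS 0).mono (Set.subset_iUnion S 0))).continuousOn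
    (fun z _ => tendsto_quadSup_iUnion hw hS hmono z)
  obtain ⟨n₀, hn₀⟩ := eventually_atTop.1 (Metric.tendstoUniformlyOn_iff.1 h ε hε)
  refine ⟨n₀, fun n hn z hz => ?_⟩
  have := (abs_lt.1 (Real.dist_eq _ _ ▸ hn₀ n hn z hz)).2
  linarith

end quadSup

/-! ### The normalized empirical process -/

/-- The normalized empirical process `n^{-1/2} ∑ (1{x_i = k} - w k)`, as a vector indexed by `k`. -/
noncomputable def empiricalFluctuation {K : ℕ} (w : Fin K → ℝ) (n : ℕ) (x : ℕ → Fin K) :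
    EuclideanSpace ℝ (Fin K) :=
  (√n)⁻¹ • ∑ i ∈ Finset.range n, (EuclideanSpace.single (x i) 1 - WithLp.toLp 2 w)

/-- Splits a sample sum into drift and fluctuation; all later dependence on the data passes through
it. -/
theorem sum_range_eq_empiricalFluctuation {K : ℕ} (w : Fin K → ℝ) (n : ℕ) (x : ℕ → Fin K)
    (F : Fin K → ℝ) :
    ∑ i ∈ Finset.range n, F (x i)
      = n * ∑ k, w k * F k + √n * ∑ k, empiricalFluctuation w n x k * F k := by
  rcases Nat.eq_zero_or_pos n with rfl | hn
  · simp
  have hn' : √(n : ℝ) ≠ 0 := by positivity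
  have e : ∀ k, √n * (empiricalFluctuation w n x k * F k)
      = ∑ i ∈ Finset.range n, ((if k = x i then F k else 0) - w k * F k) := by
    intro k
    simp only [empiricalFluctuation, PiLp.smul_apply, smul_eq_mul, WithLp.ofLp_sum, Finset.sum_apply,
      PiLp.sub_apply, PiLp.single_apply]
    rw [mul_assoc, ← mul_assoc, mul_inv_cancel₀ hn', one_mul, Finset.sum_mul]
    refine Finset.sum_congr rfl fun i _ => ?_
    split_ifs <;> ring
  rw [Finset.mul_sum (a := √(n : ℝ)), Finset.sum_congr rfl fun k _ => e k, Finset.sum_comm]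
  simp [Finset.sum_sub_distrib]

/-- The linear term has no drift because ∑ w u = 0. The error has two sources: the fluctuation of
the squared term and the cubic Taylor remainder. -/
theorem two_mul_sum_log_sub_quad_le {K : ℕ} {w : Fin K → ℝ} {n : ℕ}
    (hn : 0 < n) {x : ℕ → Fin K} {M R : ℝ}
    (hM : ∀ k, |empiricalFluctuation w n x k| ≤ M) {u : Fin K → ℝ} (huw : ∑ k, w k * u k = 0)
    (hR : ∀ k, |u k| ≤ R) (hRn : 2 * R ≤ √n) :
    |2 * ∑ i ∈ Finset.range n, Real.log (1 + u (x i) / √n)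
      - (2 * ∑ k, empiricalFluctuation w n x k * u k - ∑ k, w k * u k ^ 2)|
      ≤ (K * (M * R ^ 2) + 4 * R ^ 3) / √n := by
  have hs : 0 < √(n : ℝ) := by positivity
  have hss : √(n : ℝ) ^ 2 = n := Real.sq_sqrt (by positivity)
  set z := empiricalFluctuation w n x with hz
  set r : Fin K → ℝ := fun k => Real.log (1 + u k / √n) - (u k / √n - (u k / √n) ^ 2 / 2) with hr
  have hrb : ∀ k, |r k| ≤ 2 * (R / √n) ^ 3 := by
    intro k
    have h1 : |u k / √n| ≤ R / √n := by
      rw [abs_div, abs_of_pos hs]; gcongr; exact hR k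
    have h2 : R / √n ≤ 1 / 2 := by rw [div_le_iff₀ hs]; linarith
    refine (abs_log_one_add_sub_le (h1.trans h2)).trans ?_
    gcongr
  have e1 : ∑ i ∈ Finset.range n, u (x i) / √n = ∑ k, z k * u k := by
    rw [sum_range_eq_empiricalFluctuation w n x (fun k => u k / √n), ← hz]
    simp only [← mul_div_assoc, ← Finset.sum_div]
    rw [huw]; field_simp; ring
  have e2 : ∑ i ∈ Finset.range n, (u (x i) / √n) ^ 2
      = ∑ k, w k * u k ^ 2 + (∑ k, z k * u k ^ 2) / √n := by
    rw [sum_range_eq_empiricalFluctuation w n x (fun k => (u k / √n) ^ 2), ← hz]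
    simp only [div_pow, ← mul_div_assoc, ← Finset.sum_div, hss]
    have : (n : ℝ) ≠ 0 := by positivity
    field_simp
    linear_combination (∑ k, z k * u k ^ 2) * hss
  have e3 : ∑ i ∈ Finset.range n, Real.log (1 + u (x i) / √n)
      = ∑ k, z k * u k - (∑ k, w k * u k ^ 2 + (∑ k, z k * u k ^ 2) / √n) / 2
        + ∑ i ∈ Finset.range n, r (x i) := by
    rw [← e1, ← e2, Finset.sum_div, ← Finset.sum_sub_distrib, ← Finset.sum_add_distrib]
    exact Finset.sum_congr rfl fun i _ => by simp only [hr]; ring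
  have b1 : |∑ k, z k * u k ^ 2| ≤ K * (M * R ^ 2) := by
    refine (Finset.abs_sum_le_sum_abs _ _).trans ?_
    refine (Finset.sum_le_card_nsmul _ _ (M * R ^ 2) fun k _ => ?_).trans (by simp)
    rw [abs_mul, abs_pow]
    have := hM k
    have := hR k
    have : 0 ≤ M := (abs_nonneg _).trans (hM k)
    gcongr
  have b2 : |∑ i ∈ Finset.range n, r (x i)| ≤ 2 * R ^ 3 / √n := by
    refine (Finset.abs_sum_le_sum_abs _ _).trans ?_
    refine (Finset.sum_le_card_nsmul _ _ _ fun i _ => hrb (x i)).trans (le_of_eq ?_)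
    calc (Finset.range n).card • (2 * (R / √n) ^ 3) = √(n : ℝ) ^ 2 * (2 * (R / √n) ^ 3) := by
          rw [Finset.card_range, nsmul_eq_mul, hss]
      _ = 2 * R ^ 3 / √n := by field_simp
  have e4 : 2 * ∑ i ∈ Finset.range n, Real.log (1 + u (x i) / √n)
      - (2 * ∑ k, z k * u k - ∑ k, w k * u k ^ 2)
      = -((∑ k, z k * u k ^ 2) / √n) + 2 * ∑ i ∈ Finset.range n, r (x i) := by
    rw [e3]; ring
  rw [e4]
  refine (abs_add_le _ _).trans ?_
  rw [abs_neg, abs_div, abs_of_pos hs, abs_mul, abs_two, add_div]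
  have : |∑ k, z k * u k ^ 2| / √n ≤ K * (M * R ^ 2) / √n := by gcongr
  have e5 : 4 * R ^ 3 / √(n : ℝ) = 2 * (2 * R ^ 3 / √n) := by ring
  linarith

/-- Localization: if the log-likelihood ratio of `1 + h` is at least `c`, then the weighted squared
norm of `√n h` is bounded. -/
theorem mul_sum_sq_le_of_le_sum_log {K : ℕ} {w : Fin K → ℝ} (hw : ∀ k, 0 < w k) {n : ℕ}
    {x : ℕ → Fin K} {M A c : ℝ} (hM : ∀ k, |empiricalFluctuation w n x k| ≤ M)
    (hMn : ∀ k, 2 * M ≤ √n * w k) {h : Fin K → ℝ} (hwh : ∑ k, w k * h k = 0)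
    (hA : ∀ k, 1 + h k ≤ A) (hpos : ∀ i < n, 0 < 1 + h (x i))
    (hc : c ≤ ∑ i ∈ Finset.range n, Real.log (1 + h (x i))) :
    n * ∑ k, w k * h k ^ 2
      ≤ 4 * (√A + 1) ^ 2 * (-c + (√A + 1) ^ 2 * ∑ k, M ^ 2 / w k) := by
  have hss : √(n : ℝ) ^ 2 = n := Real.sq_sqrt (by positivity)
  set z := empiricalFluctuation w n x with hz
  set κ : ℝ := ((√A + 1) ^ 2)⁻¹ with hκ
  have hκ0 : 0 < κ := by positivity
  have h1 : ∑ i ∈ Finset.range n, Real.log (1 + h (x i))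
      ≤ ∑ i ∈ Finset.range n, (h (x i) - κ * h (x i) ^ 2) := by
    refine Finset.sum_le_sum fun i hi => ?_
    have := log_le_sub_one_sub_sq (hpos i (Finset.mem_range.1 hi)) (hA (x i))
    simpa using this
  rw [sum_range_eq_empiricalFluctuation w n x (fun k => h k - κ * h k ^ 2), ← hz] at h1
  have e1 : ∑ k, w k * (h k - κ * h k ^ 2) = - κ * ∑ k, w k * h k ^ 2 := by
    have : ∑ k, w k * (h k - κ * h k ^ 2) = ∑ k, w k * h k - κ * ∑ k, w k * h k ^ 2 := by
      rw [Finset.mul_sum, ← Finset.sum_sub_distrib]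
      exact Finset.sum_congr rfl fun k _ => by ring
    rw [this, hwh]; ring
  have e2 : √n * ∑ k, z k * (h k - κ * h k ^ 2)
      = ∑ k, z k * (√n * h k) - κ * (√n * ∑ k, z k * h k ^ 2) := by
    simp only [Finset.mul_sum, ← Finset.sum_sub_distrib]
    exact Finset.sum_congr rfl fun k _ => by ring
  -- For n large relative to M, fluctuation cancels at most half of the quadratic drift.
  have b1 : -(√n * ∑ k, z k * h k ^ 2) ≤ n / 2 * ∑ k, w k * h k ^ 2 := by
    rw [Finset.mul_sum, Finset.mul_sum, ← Finset.sum_neg_distrib]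
    refine Finset.sum_le_sum fun k _ => ?_
    have ha : - z k ≤ M := (neg_le_abs _).trans (hM k)
    have hb : - z k ≤ √n * w k / 2 := by linarith [hMn k]
    have hc' := mul_le_mul_of_nonneg_left hb (mul_nonneg (Real.sqrt_nonneg n) (sq_nonneg (h k)))
    have : √n * h k ^ 2 * (√n * w k / 2) = n / 2 * (w k * h k ^ 2) := by
      linear_combination (h k ^ 2 * w k / 2) * hss
    rw [← this]
    linarith
  -- Of the drift -κ, κ/2 is lost above and κ/4 here, leaving -κ/4.
  have b2 := sum_mul_le_young hw (δ := κ / 4) (by positivity) z (fun k => √n * h k)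
  have e3 : ∑ k, w k * (√n * h k) ^ 2 = n * ∑ k, w k * h k ^ 2 := by
    rw [Finset.mul_sum]
    exact Finset.sum_congr rfl fun k _ => by rw [mul_pow, hss]; ring
  have b3 : ∑ k, z k ^ 2 / w k ≤ ∑ k, M ^ 2 / w k := by
    refine Finset.sum_le_sum fun k _ => ?_
    have := hw k
    rw [← sq_abs]
    gcongr
    exact hM k
  rw [e1, e2] at h1
  rw [e3] at b2
  have b4 := mul_le_mul_of_nonneg_left b1 hκ0.le
  have b5 : (4 * (κ / 4))⁻¹ * ∑ k, z k ^ 2 / w k ≤ κ⁻¹ * ∑ k, M ^ 2 / w k := by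
    rw [show 4 * (κ / 4) = κ by ring]
    gcongr
  have fin : κ / 4 * (n * ∑ k, w k * h k ^ 2) ≤ -c + κ⁻¹ * ∑ k, M ^ 2 / w k := by linarith
  have hκi : (√A + 1) ^ 2 = κ⁻¹ := by rw [hκ, inv_inv]
  rw [hκi]
  have := mul_le_mul_of_nonneg_left fin (show 0 ≤ 4 * κ⁻¹ by positivity)
  have e6 : 4 * κ⁻¹ * (κ / 4 * (n * ∑ k, w k * h k ^ 2)) = n * ∑ k, w k * h k ^ 2 := by
    field_simp
  linarith

/-! ### The multivariate central limit theorem -/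

/-- The Cramér–Wold device, reducing the vector limit theorem to the scalar one. -/
theorem charFun_map_inner_one {Ω ι : Type*} [MeasurableSpace Ω] [Fintype ι] {μ : Measure Ω}
    {Z : Ω → EuclideanSpace ℝ ι} (hZ : AEMeasurable Z μ) (t : EuclideanSpace ℝ ι) :
    charFun (μ.map Z) t = charFun (μ.map fun ω => inner ℝ (Z ω) t) 1 := by
  rw [charFun_apply, charFun_apply, integral_map hZ (by fun_prop),
    integral_map (by fun_prop) (by fun_prop)]
  simp

section CLT

variable {Ω : Type*} [MeasurableSpace Ω] {P : Measure Ω} [IsProbabilityMeasure P]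
  {ι : Type*} [Fintype ι] [DecidableEq ι] {Y : ℕ → Ω → EuclideanSpace ℝ ι}

/-- The covariance matrix of a measure on a Euclidean space. -/
noncomputable def covarianceMatrix (μ : Measure (EuclideanSpace ℝ ι)) : Matrix ι ι ℝ :=
  Matrix.of fun i j => covarianceBilin μ (EuclideanSpace.single i 1) (EuclideanSpace.single j 1)

theorem dotProduct_covarianceMatrix_mulVec (μ : Measure (EuclideanSpace ℝ ι))
    (x : EuclideanSpace ℝ ι) :
    x.ofLp ⬝ᵥ (covarianceMatrix μ).mulVec x.ofLp = covarianceBilin μ x x := by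
  have hx : x = ∑ i, x i • EuclideanSpace.single i (1 : ℝ) := by
    ext j; simp [Pi.single_apply]
  conv_rhs => rw [hx]
  simp only [map_sum, map_smul, sum_apply, smul_apply,
    dotProduct, Matrix.mulVec, covarianceMatrix, Matrix.of_apply, smul_eq_mul, Finset.mul_sum]
  rw [Finset.sum_comm]
  refine Finset.sum_congr rfl fun i _ => Finset.sum_congr rfl fun j _ => by ring

theorem posSemidef_covarianceMatrix (μ : Measure (EuclideanSpace ℝ ι)) :
    (covarianceMatrix μ).PosSemidef := by
  refine Matrix.PosSemidef.of_dotProduct_mulVec_nonneg ?_ fun x => ?_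
  · ext i j
    simp [covarianceMatrix, covarianceBilin_comm]
  · have := dotProduct_covarianceMatrix_mulVec μ (WithLp.toLp 2 x)
    simp only [star_trivial] at *
    rw [this]
    exact covarianceBilin_self_nonneg _

/-- **Multivariate central limit theorem**: the normalized partial sums of a centred i.i.d. sequence
of square-integrable random vectors have a Gaussian limit. -/
theorem tendstoInDistribution_inv_sqrt_smul_sum (hY : MemLp (Y 0) 2 P) (h0 : P[Y 0] = 0)
    (hindep : iIndepFun Y P) (hident : ∀ i, IdentDistrib (Y i) (Y 0) P P) :
    TendstoInDistribution (fun (n : ℕ) ω => (√n)⁻¹ • ∑ i ∈ Finset.range n, Y i ω) atTop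
      (id : EuclideanSpace ℝ ι → EuclideanSpace ℝ ι) (fun _ => P)
      (multivariateGaussian 0 (covarianceMatrix (P.map (Y 0)))) := by
  have hm : ∀ i, AEMeasurable (Y i) P := fun i => (hident i).aemeasurable_fst
  have hZ : ∀ n : ℕ, AEMeasurable (fun ω => (√n)⁻¹ • ∑ i ∈ Finset.range n, Y i ω) P :=
    fun n => (Finset.aemeasurable_fun_sum (Finset.range n) fun i _ => hm i).fun_const_smul
      (√(n : ℝ))⁻¹
  refine ⟨hZ, aemeasurable_id, ProbabilityMeasure.tendsto_iff_tendsto_charFun.2 fun t => ?_⟩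
  have hmt : Measurable fun y : EuclideanSpace ℝ ι => inner ℝ y t := by fun_prop
  have hid : ∀ i, IdentDistrib (fun ω => inner ℝ (Y i ω) t) (fun ω => inner ℝ (Y 0 ω) t) P P :=
    fun i => (hident i).comp hmt
  have hind : iIndepFun (fun i ω => inner ℝ (Y i ω) t) P := hindep.comp (fun _ y => inner ℝ y t)
    fun _ => hmt
  have hL : MemLp (fun ω => inner ℝ (Y 0 ω) t) 2 P := hY.inner_const t
  have hint : ∫ ω, inner ℝ (Y 0 ω) t ∂P = 0 := by
    simp_rw [real_inner_comm t]
    rw [integral_inner (hY.integrable (by norm_num)), h0, inner_zero_right]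
  have key := tendstoInDistribution_inv_sqrt_mul_sum_sub (P := P)
    (X := fun i ω => inner ℝ (Y i ω) t) (Y := id)
    (P' := gaussianReal 0 Var[fun ω => inner ℝ (Y 0 ω) t; P].toNNReal) HasLaw.id hL hind hid
  have key2 := ProbabilityMeasure.tendsto_iff_tendsto_charFun.1 key.tendsto 1
  simp only [ProbabilityMeasure.coe_mk, Measure.map_id, hint, mul_zero, sub_zero] at key2 ⊢
  have e : ∀ n : ℕ, charFun (P.map fun ω => (√n)⁻¹ • ∑ i ∈ Finset.range n, Y i ω) t
      = charFun (P.map fun ω => (√n)⁻¹ * ∑ i ∈ Finset.range n, inner ℝ (Y i ω) t) 1 := by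
    intro n
    rw [charFun_map_inner_one (hZ n)]
    simp only [real_inner_smul_left, sum_inner]
  simp only [e]
  have hcov : covarianceBilin (P.map (Y 0)) t t = Var[fun ω => inner ℝ (Y 0 ω) t; P] := by
    have := Measure.isProbabilityMeasure_map (hm 0) (μ := P)
    rw [covarianceBilin_self ((memLp_map_measure_iff aestronglyMeasurable_id (hm 0)).2 hY),
      variance_map (by fun_prop) (hm 0)]
    simp only [Function.comp_def, real_inner_comm]
  convert key2 using 2
  rw [charFun_multivariateGaussian (posSemidef_covarianceMatrix _), charFun_gaussianReal,
    dotProduct_covarianceMatrix_mulVec, hcov]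
  simp [variance_nonneg]

end CLT

/-! ### Weak convergence of the empirical process -/

section empiricalFluctuation

variable {Ω : Type*} [MeasurableSpace Ω] {P : Measure Ω} [IsProbabilityMeasure P]
  {K : ℕ} {w : Fin K → ℝ} {X : ℕ → Ω → Fin K}

theorem exists_tendstoInDistribution_empiricalFluctuation (hw : ∑ k, w k = 1)
    (hX : ∀ i, Measurable (X i)) (hindep : iIndepFun X P) (hlaw : ∀ i k, P.real {ω | X i ω = k} = w k) :
    ∃ ν : ProbabilityMeasure (EuclideanSpace ℝ (Fin K)),
      TendstoInDistribution (fun n ω => empiricalFluctuation w n fun i => X i ω) atTop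
        (id : EuclideanSpace ℝ (Fin K) → EuclideanSpace ℝ (Fin K)) (fun _ => P) (ν : Measure _) := by
  set G : Fin K → EuclideanSpace ℝ (Fin K) :=
    fun k => EuclideanSpace.single k 1 - WithLp.toLp 2 w with hG
  have hGm : Measurable G := measurable_of_finite G
  have hmap : ∀ i, P.map (X i) = P.map (X 0) := by
    intro i
    refine Measure.ext_of_singleton fun k => ?_
    rw [Measure.map_apply (hX i) (measurableSet_singleton k),
      Measure.map_apply (hX 0) (measurableSet_singleton k)]
    have := (hlaw i k).trans (hlaw 0 k).symm
    exact (measureReal_eq_measureReal_iff).1 this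
  have hident : ∀ i, IdentDistrib (fun ω => G (X i ω)) (fun ω => G (X 0 ω)) P P := fun i =>
    (IdentDistrib.mk (hX i).aemeasurable (hX 0).aemeasurable (hmap i)).comp hGm
  have hind : iIndepFun (fun i ω => G (X i ω)) P := hindep.comp (fun _ => G) fun _ => hGm
  have hL : MemLp (fun ω => G (X 0 ω)) 2 P := by
    refine MemLp.of_bound (hGm.comp (hX 0)).aestronglyMeasurable (∑ k, ‖G k‖) ?_
    exact ae_of_all _ fun ω => Finset.single_le_sum (f := fun k => ‖G k‖)
      (fun k _ => norm_nonneg _) (Finset.mem_univ _)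
  have h0 : ∫ ω, G (X 0 ω) ∂P = 0 := by
    rw [← integral_map (φ := X 0) (f := G) (hX 0).aemeasurable hGm.aestronglyMeasurable,
      integral_fintype (Integrable.of_finite)]
    have : ∀ k, (P.map (X 0)).real {k} = w k := fun k => by
      rw [map_measureReal_apply (hX 0) (measurableSet_singleton k)]
      exact hlaw 0 k
    ext j
    simp [this, hG, Pi.single_apply, mul_sub, ← Finset.sum_mul, hw]
  exact ⟨⟨multivariateGaussian 0 (covarianceMatrix (P.map fun ω => G (X 0 ω))),
    isGaussian_multivariateGaussian.toIsProbabilityMeasure⟩, tendstoInDistribution_inv_sqrt_smul_sum hL h0 hind hident⟩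

theorem measurable_empiricalFluctuation (hX : ∀ i, Measurable (X i)) (n : ℕ) :
    Measurable fun ω => empiricalFluctuation w n fun i => X i ω := by
  have hG : Measurable fun k : Fin K =>
    (EuclideanSpace.single k 1 - WithLp.toLp 2 w : EuclideanSpace ℝ (Fin K)) := measurable_of_finite _
  exact (Finset.measurable_fun_sum (Finset.range n) fun i _ => hG.comp (hX i)).fun_const_smul
    (√(n : ℝ))⁻¹

/-- The normalized empirical process is bounded in probability. -/
theorem exists_forall_measure_empiricalFluctuation_le (hw : ∑ k, w k = 1)
    (hX : ∀ i, Measurable (X i)) (hindep : iIndepFun X P) (hlaw : ∀ i k, P.real {ω | X i ω = k} = w k)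
    {ε : ENNReal} (hε : 0 < ε) :
    ∃ M : ℝ, ∀ n, P {ω | ¬ ‖empiricalFluctuation w n fun i => X i ω‖ ≤ M} ≤ ε := by
  obtain ⟨ν, hν⟩ := exists_tendstoInDistribution_empiricalFluctuation hw hX hindep hlaw
  have h := ProbabilityMeasure.tendsto_iff_tendsto_charFun.1 hν.tendsto
  simp only [ProbabilityMeasure.coe_mk] at h
  have : ∀ n, IsProbabilityMeasure (P.map fun ω => empiricalFluctuation w n fun i => X i ω) :=
    fun n => Measure.isProbabilityMeasure_map (hν.forall_aemeasurable n)
  -- Convergence of characteristic functions to a limit continuous at 0 gives tightness over all n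
  -- at once.
  have ht := isTightMeasureSet_of_tendsto_charFun
    (f := charFun ((ν : Measure (EuclideanSpace ℝ (Fin K))).map id)) (by fun_prop) h
  obtain ⟨C, hC, hCε⟩ := isTightMeasureSet_iff_exists_isCompact_measure_compl_le.1 ht ε hε
  obtain ⟨M, hM⟩ := hC.isBounded.exists_norm_le
  refine ⟨M, fun n => ?_⟩
  refine le_trans ?_ (hCε _ ⟨n, rfl⟩)
  rw [Measure.map_apply (measurable_empiricalFluctuation hX n) hC.isClosed.measurableSet.compl]
  refine measure_mono fun ω hω hmem => hω (hM _ hmem)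

end empiricalFluctuation

/-! ### Mixture densities -/

section Mixture

variable {d K : ℕ} {Θ : Set (EuclideanSpace ℝ (Fin d))} {p : Θ → Fin K → ℝ}

theorem integrable_component (hp_meas : ∀ k, Measurable fun θ : Θ => p θ k)
    (hp_nonneg : ∀ θ k, 0 ≤ p θ k) (hp_sum : ∀ θ, ∑ k, p θ k = 1) (μ : Measure Θ)
    [IsFiniteMeasure μ] (k : Fin K) : Integrable (fun θ => p θ k) μ := by
  refine Integrable.of_bound (hp_meas k).aestronglyMeasurable 1 (ae_of_all _ fun θ => ?_)
  rw [Real.norm_of_nonneg (hp_nonneg θ k), ← hp_sum θ]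
  exact Finset.single_le_sum (f := fun k => p θ k) (fun j _ => hp_nonneg θ j) (Finset.mem_univ k)

theorem mixtureDensity_nonneg (hp_nonneg : ∀ θ k, 0 ≤ p θ k) (g : ProbabilityMeasure Θ)
    (k : Fin K) : 0 ≤ mixtureDensity p g k :=
  integral_nonneg fun θ => hp_nonneg θ k

theorem sum_mixtureDensity (hp_meas : ∀ k, Measurable fun θ : Θ => p θ k)
    (hp_nonneg : ∀ θ k, 0 ≤ p θ k) (hp_sum : ∀ θ, ∑ k, p θ k = 1) (g : ProbabilityMeasure Θ) :
    ∑ k, mixtureDensity p g k = 1 := by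
  simp only [mixtureDensity]
  rw [← integral_finsetSum _ fun k _ => integrable_component hp_meas hp_nonneg hp_sum _ k]
  simp [hp_sum]

theorem mixtureDensity_le_one (hp_meas : ∀ k, Measurable fun θ : Θ => p θ k)
    (hp_nonneg : ∀ θ k, 0 ≤ p θ k) (hp_sum : ∀ θ, ∑ k, p θ k = 1) (g : ProbabilityMeasure Θ)
    (k : Fin K) : mixtureDensity p g k ≤ 1 := by
  rw [← sum_mixtureDensity hp_meas hp_nonneg hp_sum g]
  exact Finset.single_le_sum (f := fun k => mixtureDensity p g k)
    (fun j _ => mixtureDensity_nonneg hp_nonneg g j) (Finset.mem_univ k)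

/-- Convexity of the model, needed for the local parameter sets to be nested. -/
theorem exists_mixtureDensity_convexComb (hp_meas : ∀ k, Measurable fun θ : Θ => p θ k)
    (hp_nonneg : ∀ θ k, 0 ≤ p θ k) (hp_sum : ∀ θ, ∑ k, p θ k = 1) (g g' : ProbabilityMeasure Θ)
    {t : ℝ} (ht0 : 0 ≤ t) (ht1 : t ≤ 1) :
    ∃ g'' : ProbabilityMeasure Θ, ∀ k,
      mixtureDensity p g'' k = t * mixtureDensity p g k + (1 - t) * mixtureDensity p g' k := by
  refine ⟨⟨ENNReal.ofReal t • (g : Measure Θ) + ENNReal.ofReal (1 - t) • (g' : Measure Θ),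
    ⟨?_⟩⟩, fun k => ?_⟩
  · simp [← ENNReal.ofReal_add ht0 (sub_nonneg.2 ht1)]
  · have hi := fun μ [IsFiniteMeasure μ] => integrable_component hp_meas hp_nonneg hp_sum μ k
    simp only [mixtureDensity, ProbabilityMeasure.coe_mk]
    rw [integral_add_measure ((hi _).smul_measure ENNReal.ofReal_ne_top)
      ((hi _).smul_measure ENNReal.ofReal_ne_top), integral_smul_measure, integral_smul_measure,
      ENNReal.toReal_ofReal ht0, ENNReal.toReal_ofReal (sub_nonneg.2 ht1)]
    simp

end Mixture

/-! ### Log-likelihoods -/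

section LogLikelihood

variable {K : ℕ} {n : ℕ} {x : ℕ → Fin K} {f f₀ : Fin K → ℝ}

theorem logLikelihood_of_pos (h : ∀ i < n, 0 < f (x i)) :
    logLikelihood n x f = ((∑ i ∈ Finset.range n, Real.log (f (x i)) : ℝ) : EReal) := by
  let φ : ℝ →+ EReal := ⟨⟨Real.toEReal, EReal.coe_zero⟩, EReal.coe_add⟩
  refine Eq.trans ?_ (map_sum φ (fun i => Real.log (f (x i))) (Finset.range n)).symm
  exact Finset.sum_congr rfl fun i hi => ENNReal.log_ofReal_of_pos (h i (Finset.mem_range.1 hi))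

theorem logLikelihood_of_nonpos {i : ℕ} (hi : i < n) (h : f (x i) ≤ 0) :
    logLikelihood n x f = ⊥ := by
  rw [logLikelihood, ← Finset.add_sum_erase _ _ (Finset.mem_range.2 hi), ENNReal.log_ofReal,
    if_pos h, EReal.bot_add]

theorem logLikelihood_congr {y : ℕ → Fin K} (h : ∀ i < n, x i = y i) :
    logLikelihood n x f = logLikelihood n y f :=
  Finset.sum_congr rfl fun i hi => by rw [h i (Finset.mem_range.1 hi)]

theorem pos_of_coe_le_logLikelihood {r : ℝ} (h : (r : EReal) ≤ logLikelihood n x f) :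
    ∀ i < n, 0 < f (x i) := by
  intro i hi
  by_contra hneg
  rw [logLikelihood_of_nonpos hi (not_lt.1 hneg), le_bot_iff] at h
  exact EReal.coe_ne_bot _ h

theorem sum_log_div (h : ∀ i < n, 0 < f (x i)) (h₀ : ∀ i < n, 0 < f₀ (x i)) :
    ∑ i ∈ Finset.range n, Real.log (f (x i) / f₀ (x i))
      = ∑ i ∈ Finset.range n, Real.log (f (x i)) - ∑ i ∈ Finset.range n, Real.log (f₀ (x i)) := by
  rw [← Finset.sum_sub_distrib]
  refine Finset.sum_congr rfl fun i hi => ?_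
  have hi := Finset.mem_range.1 hi
  exact Real.log_div (h i hi).ne' (h₀ i hi).ne'

end LogLikelihood

/-! ### Likelihood ratios over the mixing distributions -/

section LikelihoodRatio

variable {d K : ℕ} {Θ : Set (EuclideanSpace ℝ (Fin d))} {p : Θ → Fin K → ℝ}
  {g₀ : ProbabilityMeasure Θ} {n : ℕ} {x : ℕ → Fin K}

/-- An element of `𝒢_n(c)` with `c < 0` has a log-likelihood ratio of at least `c`. -/
theorem le_sum_log_of_mem_approxMLESet (h_full : ∀ k, 0 < mixtureDensity p g₀ k) {c : ℝ}
    (hc : c < 0) {g : ProbabilityMeasure Θ} (hg : g ∈ approxMLESet p g₀ n x c) :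
    (∀ i < n, 0 < mixtureDensity p g (x i)) ∧
      c ≤ ∑ i ∈ Finset.range n,
        Real.log (mixtureDensity p g (x i) / mixtureDensity p g₀ (x i)) := by
  have h0 := logLikelihood_of_pos (n := n) (x := x) (f := mixtureDensity p g₀)
    fun i _ => h_full (x i)
  have key : logLikelihood n x (mixtureDensity p g₀) + (c : EReal)
      ≤ logLikelihood n x (mixtureDensity p g) := by
    rcases hg with hg | hg
    · exact hg
    -- An NPMLE does at least as well as g₀, hence better than the negative margin c demands.
    · refine le_trans ?_ (hg g₀)
      rw [h0, ← EReal.coe_add, EReal.coe_le_coe_iff]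
      linarith
  rw [h0, ← EReal.coe_add] at key
  have hpos := pos_of_coe_le_logLikelihood key
  refine ⟨hpos, ?_⟩
  rw [logLikelihood_of_pos hpos, EReal.coe_le_coe_iff] at key
  rw [sum_log_div hpos fun i _ => h_full (x i)]
  linarith

/-- The likelihood ratio statistic is a real number, namely the least upper bound of the
log-likelihood ratios of the mixing distributions with nonvanishing likelihood. -/
theorem exists_likelihoodRatioStat_eq_coe (hp_meas : ∀ k, Measurable fun θ : Θ => p θ k)
    (hp_nonneg : ∀ θ k, 0 ≤ p θ k) (hp_sum : ∀ θ, ∑ k, p θ k = 1)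
    (h_full : ∀ k, 0 < mixtureDensity p g₀ k) (n : ℕ) (x : ℕ → Fin K) :
    ∃ r : ℝ, likelihoodRatioStat p g₀ n x = r ∧
      (∀ g, (∀ i < n, 0 < mixtureDensity p g (x i)) → 2 * ∑ i ∈ Finset.range n,
        Real.log (mixtureDensity p g (x i) / mixtureDensity p g₀ (x i)) ≤ r) ∧
      ∀ B : ℝ, (∀ g, (∀ i < n, 0 < mixtureDensity p g (x i)) → 2 * ∑ i ∈ Finset.range n,
        Real.log (mixtureDensity p g (x i) / mixtureDensity p g₀ (x i)) ≤ B) → r ≤ B := by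
  have h0p : ∀ i < n, 0 < mixtureDensity p g₀ (x i) := fun i _ => h_full (x i)
  have h0 := logLikelihood_of_pos h0p
  set l : ProbabilityMeasure Θ → ℝ :=
    fun g => ∑ i ∈ Finset.range n, Real.log (mixtureDensity p g (x i)) with hl
  have hle : ∀ B : ℝ, (∀ g, (∀ i < n, 0 < mixtureDensity p g (x i)) → l g ≤ B) →
      (⨆ g : ProbabilityMeasure Θ, logLikelihood n x (mixtureDensity p g)) ≤ B := by
    refine fun B hB => iSup_le fun g => ?_
    by_cases hg : ∀ i < n, 0 < mixtureDensity p g (x i)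
    · rw [logLikelihood_of_pos hg, EReal.coe_le_coe_iff]
      exact hB g hg
    · push Not at hg
      obtain ⟨i, hi, hneg⟩ := hg
      rw [logLikelihood_of_nonpos hi hneg]
      exact bot_le
  have hge : ∀ g, logLikelihood n x (mixtureDensity p g)
      ≤ ⨆ g : ProbabilityMeasure Θ, logLikelihood n x (mixtureDensity p g) :=
    fun g => le_iSup (fun g => logLikelihood n x (mixtureDensity p g)) g
  -- Densities for counting measure are at most 1, so log-likelihoods are at most 0.
  have htop : (⨆ g : ProbabilityMeasure Θ, logLikelihood n x (mixtureDensity p g)) ≠ ⊤ := by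
    refine ne_top_of_le_ne_top (EReal.coe_ne_top 0) (hle 0 fun g hg => ?_)
    exact Finset.sum_nonpos fun i hi => Real.log_nonpos
      (hg i (Finset.mem_range.1 hi)).le (mixtureDensity_le_one hp_meas hp_nonneg hp_sum g _)
  have hbot : (⨆ g : ProbabilityMeasure Θ, logLikelihood n x (mixtureDensity p g)) ≠ ⊥ :=
    ne_bot_of_le_ne_bot (h0 ▸ EReal.coe_ne_bot _) (hge g₀)
  obtain ⟨s, hs⟩ : ∃ s : ℝ, (⨆ g : ProbabilityMeasure Θ,
      logLikelihood n x (mixtureDensity p g)) = s := ⟨_, (EReal.coe_toReal htop hbot).symm⟩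
  rw [hs] at hle hge
  refine ⟨2 * (s - l g₀), ?_, fun g hg => ?_, fun B hB => ?_⟩
  · rw [likelihoodRatioStat, hs, h0]
    norm_cast
  · have := hge g
    rw [logLikelihood_of_pos hg, EReal.coe_le_coe_iff] at this
    rw [sum_log_div hg h0p]
    linarith
  · have := hle (B / 2 + l g₀) fun g hg => by
      have := hB g hg
      rw [sum_log_div hg h0p] at this
      simp only [hl]
      linarith
    rw [EReal.coe_le_coe_iff] at this
    linarith

/-- The supremum may be uncountable, but the statistic factors through finitely many finite-valued
observations. Using n + 1 of them keeps the index type inhabited when n = 0. -/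
theorem measurable_likelihoodRatioStat {Ω : Type*} [MeasurableSpace Ω] {X : ℕ → Ω → Fin K}
    (hX : ∀ i, Measurable (X i)) (n : ℕ) :
    Measurable fun ω => (likelihoodRatioStat p g₀ n fun i => X i ω).toReal := by
  have h : (fun ω => (likelihoodRatioStat p g₀ n fun i => X i ω).toReal)
      = (fun y : Fin (n + 1) → Fin K =>
          (likelihoodRatioStat p g₀ n fun i => y (Fin.ofNat (n + 1) i)).toReal) ∘
        fun ω i => X i ω := by
    funext ω
    have e : ∀ f, logLikelihood n (fun i => X i ω) f
        = logLikelihood n (fun i => X (Fin.ofNat (n + 1) i) ω) f := fun f =>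
      logLikelihood_congr fun i hi => by
        simp [Nat.mod_eq_of_lt (Nat.lt_succ_of_lt hi)]
    simp only [Function.comp_apply, likelihoodRatioStat, e]
  rw [h]
  exact (measurable_of_finite _).comp (measurable_pi_lambda _ fun i => hX i)

end LikelihoodRatio

/-! ### Asymptotics of the likelihood ratio -/

section Asymptotics

variable {d K : ℕ} {Θ : Set (EuclideanSpace ℝ (Fin d))} {p : Θ → Fin K → ℝ}
  {g₀ : ProbabilityMeasure Θ}

/-- The rescaled relative differences `√n (f_g / f_{g₀} - 1)`. -/
def localParameterSet (p : Θ → Fin K → ℝ) (g₀ : ProbabilityMeasure Θ) (n : ℕ) :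
    Set (Fin K → ℝ) :=
  Set.range fun (g : ProbabilityMeasure Θ) k =>
    √n * (mixtureDensity p g k / mixtureDensity p g₀ k - 1)

theorem zero_mem_localParameterSet (h_full : ∀ k, 0 < mixtureDensity p g₀ k) (n : ℕ) :
    0 ∈ localParameterSet p g₀ n :=
  ⟨g₀, funext fun k => by simp [div_self (h_full k).ne']⟩

theorem monotone_localParameterSet (hp_meas : ∀ k, Measurable fun θ : Θ => p θ k)
    (hp_nonneg : ∀ θ k, 0 ≤ p θ k) (hp_sum : ∀ θ, ∑ k, p θ k = 1)
    (h_full : ∀ k, 0 < mixtureDensity p g₀ k) : Monotone (localParameterSet p g₀) := by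
  rintro m n hmn _ ⟨g, rfl⟩
  rcases Nat.eq_zero_or_pos n with rfl | hn
  · rw [Nat.le_zero.1 hmn]
    exact ⟨g, rfl⟩
  have hs : 0 < √(n : ℝ) := by positivity
  -- Shrinking g towards g₀ by √m / √n offsets the larger scale √n.
  obtain ⟨g', hg'⟩ := exists_mixtureDensity_convexComb hp_meas hp_nonneg hp_sum g g₀
    (t := √m / √n) (by positivity)
    ((div_le_one hs).2 (Real.sqrt_le_sqrt (by exact_mod_cast hmn)))
  refine ⟨g', funext fun k => ?_⟩
  have := (h_full k).ne'
  simp only [hg' k]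
  field_simp
  ring

theorem sum_mul_relDiff_eq_zero (hp_meas : ∀ k, Measurable fun θ : Θ => p θ k)
    (hp_nonneg : ∀ θ k, 0 ≤ p θ k) (hp_sum : ∀ θ, ∑ k, p θ k = 1)
    (h_full : ∀ k, 0 < mixtureDensity p g₀ k) (g : ProbabilityMeasure Θ) :
    ∑ k, mixtureDensity p g₀ k * (mixtureDensity p g k / mixtureDensity p g₀ k - 1) = 0 := by
  have : ∀ k, mixtureDensity p g₀ k * (mixtureDensity p g k / mixtureDensity p g₀ k - 1)
      = mixtureDensity p g k - mixtureDensity p g₀ k := fun k => by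
    have := (h_full k).ne'
    field_simp
  simp [this, sum_mixtureDensity hp_meas hp_nonneg hp_sum]

theorem mixtureDensity_div_le (hp_meas : ∀ k, Measurable fun θ : Θ => p θ k)
    (hp_nonneg : ∀ θ k, 0 ≤ p θ k) (hp_sum : ∀ θ, ∑ k, p θ k = 1)
    (h_full : ∀ k, 0 < mixtureDensity p g₀ k) (g : ProbabilityMeasure Θ) (k : Fin K) :
    mixtureDensity p g k / mixtureDensity p g₀ k ≤ ∑ j, (mixtureDensity p g₀ j)⁻¹ := by
  refine le_trans ?_ (Finset.single_le_sum (f := fun j => (mixtureDensity p g₀ j)⁻¹)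
    (fun j _ => (inv_pos.2 (h_full j)).le) (Finset.mem_univ k))
  rw [div_eq_mul_inv]
  exact mul_le_of_le_one_left (inv_pos.2 (h_full k)).le
    (mixtureDensity_le_one hp_meas hp_nonneg hp_sum g k)

/-- A crude bound that handles the finitely many n below the localization threshold. -/
theorem chiSqDiv_le (hp_meas : ∀ k, Measurable fun θ : Θ => p θ k)
    (hp_nonneg : ∀ θ k, 0 ≤ p θ k) (hp_sum : ∀ θ, ∑ k, p θ k = 1)
    (h_full : ∀ k, 0 < mixtureDensity p g₀ k) (g : ProbabilityMeasure Θ) :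
    chiSqDiv (mixtureDensity p g) (mixtureDensity p g₀)
      ≤ (∑ j, (mixtureDensity p g₀ j)⁻¹ + 1) ^ 2 := by
  set A := ∑ j, (mixtureDensity p g₀ j)⁻¹
  have h : ∀ k, (mixtureDensity p g k / mixtureDensity p g₀ k - 1) ^ 2 * mixtureDensity p g₀ k
      ≤ (A + 1) ^ 2 * mixtureDensity p g₀ k := fun k => by
    have h1 := mixtureDensity_div_le hp_meas hp_nonneg hp_sum h_full g k
    have h2 : 0 ≤ mixtureDensity p g k / mixtureDensity p g₀ k :=
      div_nonneg (mixtureDensity_nonneg hp_nonneg g k) (h_full k).le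
    have h3 : |mixtureDensity p g k / mixtureDensity p g₀ k - 1| ≤ A + 1 := by
      rw [abs_le]; constructor <;> linarith
    refine mul_le_mul_of_nonneg_right (sq_le_sq' ?_ ?_) (h_full k).le <;>
    linarith [abs_le.1 h3]
  refine (Finset.sum_le_sum fun k _ => h k).trans_eq ?_
  rw [← Finset.mul_sum, sum_mixtureDensity hp_meas hp_nonneg hp_sum, mul_one]

theorem exists_forall_mul_chiSqDiv_le (hp_meas : ∀ k, Measurable fun θ : Θ => p θ k)
    (hp_nonneg : ∀ θ k, 0 ≤ p θ k) (hp_sum : ∀ θ, ∑ k, p θ k = 1)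
    (h_full : ∀ k, 0 < mixtureDensity p g₀ k) (M c : ℝ) :
    ∃ R : ℝ, ∃ n₀ : ℕ, ∀ n ≥ n₀, ∀ x : ℕ → Fin K,
      ‖empiricalFluctuation (mixtureDensity p g₀) n x‖ ≤ M →
      ∀ g, (∀ i < n, 0 < mixtureDensity p g (x i)) →
        c ≤ ∑ i ∈ Finset.range n,
          Real.log (mixtureDensity p g (x i) / mixtureDensity p g₀ (x i)) →
        n * chiSqDiv (mixtureDensity p g) (mixtureDensity p g₀) ≤ R := by
  have hsqrt : Tendsto (fun n : ℕ => √(n : ℝ)) atTop atTop :=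
    Real.tendsto_sqrt_atTop.comp tendsto_natCast_atTop_atTop
  have hev : ∀ᶠ n : ℕ in atTop, ∀ k, 2 * M ≤ √n * mixtureDensity p g₀ k := by
    refine eventually_all.2 fun k => ?_
    filter_upwards [hsqrt.eventually_ge_atTop (2 * M / mixtureDensity p g₀ k)] with n hn
    exact (div_le_iff₀ (h_full k)).1 hn
  obtain ⟨n₀, hn₀⟩ := eventually_atTop.1 hev
  set A := ∑ j, (mixtureDensity p g₀ j)⁻¹
  refine ⟨4 * (√A + 1) ^ 2 * (-c + (√A + 1) ^ 2 * ∑ k, M ^ 2 / mixtureDensity p g₀ k), n₀,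
    fun n hn x hx g hg hc => ?_⟩
  have := mul_sum_sq_le_of_le_sum_log h_full (n := n) (x := x) (M := M)
    (A := A) (c := c)
    (h := fun k => mixtureDensity p g k / mixtureDensity p g₀ k - 1)
    (fun k => (PiLp.norm_apply_le _ k).trans hx) (hn₀ n hn)
    (sum_mul_relDiff_eq_zero hp_meas hp_nonneg hp_sum h_full g)
    (fun k => by
      rw [add_sub_cancel]
      exact mixtureDensity_div_le hp_meas hp_nonneg hp_sum h_full g k)
    (fun i hi => by rw [add_sub_cancel]; exact div_pos (hg i hi) (h_full _))
    (by simpa only [add_sub_cancel] using hc)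
  simpa only [chiSqDiv, mul_comm (_ ^ 2)] using this

/-- On bounded sets of values of the empirical process, the likelihood ratio statistic is uniformly
close to the supremum of a quadratic function over the cone generated by the local parameters. -/
theorem exists_forall_abs_likelihoodRatioStat_sub_le
    (hp_meas : ∀ k, Measurable fun θ : Θ => p θ k)
    (hp_nonneg : ∀ θ k, 0 ≤ p θ k) (hp_sum : ∀ θ, ∑ k, p θ k = 1)
    (h_full : ∀ k, 0 < mixtureDensity p g₀ k) (M : ℝ) {ε : ℝ} (hε : 0 < ε) :
    ∃ n₀ : ℕ, ∀ n ≥ n₀, ∀ x : ℕ → Fin K,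
      ‖empiricalFluctuation (mixtureDensity p g₀) n x‖ ≤ M →
      |(likelihoodRatioStat p g₀ n x).toReal
        - quadSup (mixtureDensity p g₀) (⋃ n, localParameterSet p g₀ n)
            (empiricalFluctuation (mixtureDensity p g₀) n x)| ≤ ε := by
  set w := mixtureDensity p g₀ with hw
  have h0S := zero_mem_localParameterSet h_full
  -- Level c = 0 suffices: a g with negative log-likelihood ratio is beaten by g₀.
  obtain ⟨R₁, n₁, h₁⟩ := exists_forall_mul_chiSqDiv_le hp_meas hp_nonneg hp_sum h_full M 0
  obtain ⟨n₂, h₂⟩ := exists_forall_quadSup_iUnion_le h_full (fun n => ⟨0, h0S n⟩)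
    (monotone_localParameterSet hp_meas hp_nonneg hp_sum h_full)
    (isCompact_closedBall (0 : EuclideanSpace ℝ (Fin K)) M) (half_pos hε)
  -- The first bound localizes competitive g for the likelihood; the second, from Young with δ =
  -- 1/4, localizes u where the quadratic is nonnegative.
  set R := max R₁ (4 * ∑ k, M ^ 2 / w k)
  set ρ := ∑ j, √(R / w j)
  set C := K * (M * ρ ^ 2) + 4 * ρ ^ 3
  have hsqrt : Tendsto (fun n : ℕ => √(n : ℝ)) atTop atTop :=
    Real.tendsto_sqrt_atTop.comp tendsto_natCast_atTop_atTop
  obtain ⟨n₀, hn₀⟩ := eventually_atTop.1 <|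
    (eventually_ge_atTop n₁).and <| (eventually_ge_atTop n₂).and <|
    (eventually_gt_atTop 0).and <| (hsqrt.eventually_ge_atTop (2 * ρ)).and
      (hsqrt.eventually_ge_atTop (C / (ε / 2)))
  refine ⟨n₀, fun n hn x hx => ?_⟩
  obtain ⟨hn1, hn2, hnpos, hnρ, hnC⟩ := hn₀ n hn
  have hs : 0 < √(n : ℝ) := by positivity
  have hss : √(n : ℝ) ^ 2 = n := Real.sq_sqrt (by positivity)
  have hCε : C / √n ≤ ε / 2 := by
    rw [div_le_iff₀ hs, ← div_le_iff₀' (half_pos hε)]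
    exact hnC
  set z := empiricalFluctuation w n x with hz
  have hzM : ∀ k, |z k| ≤ M := fun k => (PiLp.norm_apply_le _ k).trans hx
  set u : ProbabilityMeasure Θ → Fin K → ℝ :=
    fun g k => √n * (mixtureDensity p g k / w k - 1) with hu
  have hlog : ∀ g k, 1 + u g k / √n = mixtureDensity p g k / w k := fun g k => by
    simp only [hu]; field_simp; ring
  have huw : ∀ g, ∑ k, w k * u g k = 0 := fun g => by
    have := congrArg (√(n : ℝ) * ·) (sum_mul_relDiff_eq_zero hp_meas hp_nonneg hp_sum h_full g)
    simp only [mul_zero, Finset.mul_sum] at this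
    rw [← this]
    exact Finset.sum_congr rfl fun k _ => by simp only [hu, ← hw]; ring
  have hexp : ∀ g, ∑ k, w k * u g k ^ 2 ≤ R →
      |2 * ∑ i ∈ Finset.range n, Real.log (mixtureDensity p g (x i) / w (x i))
        - (2 * ∑ k, z k * u g k - ∑ k, w k * u g k ^ 2)| ≤ ε / 2 := fun g hg => by
    have := two_mul_sum_log_sub_quad_le hnpos hzM (huw g) (abs_le_sum_sqrt h_full hg) hnρ
    simp only [hlog] at this
    exact this.trans hCε
  obtain ⟨r, hr, hr_ge, hr_le⟩ :=
    exists_likelihoodRatioStat_eq_coe hp_meas hp_nonneg hp_sum h_full n x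
  have hr0 : 0 ≤ r := by
    have := hr_ge g₀ fun i _ => h_full (x i)
    simpa [div_self (h_full _).ne'] using this
  have hT : ∀ g, u g ∈ ⋃ n, localParameterSet p g₀ n :=
    fun g => Set.mem_iUnion.2 ⟨n, g, rfl⟩
  rw [hr, EReal.toReal_coe, abs_sub_le_iff]
  constructor
  · rw [sub_le_iff_le_add]
    refine hr_le _ fun g hg => ?_
    rcases lt_or_ge (∑ i ∈ Finset.range n, Real.log (mixtureDensity p g (x i) / w (x i))) 0
      with hneg | hpos
    · have := quadSup_nonneg h_full (Set.mem_iUnion.2 ⟨n, h0S n⟩) z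
      linarith
    · have hR : ∑ k, w k * u g k ^ 2 ≤ R := by
        refine le_trans (le_of_eq ?_) ((h₁ n hn1 x hx g hg hpos).trans (le_max_left _ _))
        rw [chiSqDiv, Finset.mul_sum]
        refine Finset.sum_congr rfl fun k _ => ?_
        simp only [hu, mul_pow, hss]
        ring
      have h3 := (abs_le.1 (hexp g hR)).2
      have h4 := le_quadSup h_full (hT g) z
      linarith
  -- Only this direction needs Dini: ε/2 goes to the union, ε/2 to the expansion.
  · have h3 := h₂ n hn2 z (by simpa using hx)
    have h4 : quadSup w (localParameterSet p g₀ n) z ≤ r + ε / 2 := by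
      refine quadSup_le ⟨0, h0S n⟩ ?_
      rintro _ ⟨g, rfl⟩
      change 2 * ∑ k, z k * u g k - ∑ k, w k * u g k ^ 2 ≤ _
      rcases lt_or_ge (2 * ∑ k, z k * u g k - ∑ k, w k * u g k ^ 2) 0 with hneg | hpos
      · linarith
      · have hR : ∑ k, w k * u g k ^ 2 ≤ R := by
          refine le_trans ?_ (le_max_right _ _)
          have hy := sum_mul_le_young h_full (δ := 1 / 4) (by norm_num) z (u g)
          have hzz : ∑ k, z k ^ 2 / w k ≤ ∑ k, M ^ 2 / w k := by
            refine Finset.sum_le_sum fun k _ => ?_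
            have := h_full k
            rw [← sq_abs]
            gcongr
            exact hzM k
          norm_num at hy
          linarith
        -- Bounded u and large n put the ratio f_g / w at 1/2 or more, so the likelihood does not
        -- vanish.
        have hadm : ∀ i < n, 0 < mixtureDensity p g (x i) := by
          intro i _
          have h5 := abs_le_sum_sqrt h_full hR (x i)
          have h6 : |u g (x i) / √n| ≤ 1 / 2 := by
            rw [abs_div, abs_of_pos hs, div_le_iff₀ hs]
            linarith
          have h7 : 0 < mixtureDensity p g (x i) / w (x i) := by
            rw [← hlog]
            linarith [(abs_le.1 h6).1]
          exact (div_pos_iff_of_pos_right (h_full _)).1 h7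
        have h5 := (abs_le.1 (hexp g hR)).1
        have h6 := hr_ge g hadm
        linarith
    linarith

end Asymptotics

/-! ### From deterministic bounds to probability -/

theorem mainTheorem10 {d K : ℕ} {Θ : Set (EuclideanSpace ℝ (Fin d))}
    (p : Θ → Fin K → ℝ)
    (hp_meas : ∀ k : Fin K, Measurable fun θ : Θ => p θ k)
    (hp_nonneg : ∀ (θ : Θ) (k : Fin K), 0 ≤ p θ k)
    (hp_sum : ∀ θ : Θ, ∑ k, p θ k = 1)
    (g₀ : ProbabilityMeasure Θ)
    (h_full : ∀ k : Fin K, 0 < mixtureDensity p g₀ k)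
    {Ω : Type*} [MeasurableSpace Ω] (P : Measure Ω) [IsProbabilityMeasure P]
    (X : ℕ → Ω → Fin K)
    (hX_meas : ∀ i : ℕ, Measurable (X i))
    (hX_indep : iIndepFun X P)
    (hX_law : ∀ (i : ℕ) (k : Fin K), P.real {ω | X i ω = k} = mixtureDensity p g₀ k) :
    (∀ c : ℝ, c < 0 →
      IsBoundedInProbability P fun n ω =>
        ⨆ g ∈ approxMLESet p g₀ n (fun i => X i ω) c,
          ENNReal.ofReal (n * chiSqDiv (mixtureDensity p g) (mixtureDensity p g₀))) ∧
    (∀ (n : ℕ) (ω : Ω), likelihoodRatioStat p g₀ n (fun i => X i ω) ≠ ⊥ ∧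
      likelihoodRatioStat p g₀ n (fun i => X i ω) ≠ ⊤) ∧
    ∃ ν : ProbabilityMeasure ℝ, IsTightMeasureSet {(ν : Measure ℝ)} ∧
      TendstoInDistribution
        (fun (n : ℕ) (ω : Ω) => (likelihoodRatioStat p g₀ n (fun i => X i ω)).toReal)
        atTop (id : ℝ → ℝ) (fun _ => P) (ν : Measure ℝ) := by
  have hw := sum_mixtureDensity hp_meas hp_nonneg hp_sum g₀
  refine ⟨fun c hc ε hε => ?_, fun n ω => ?_, ?_⟩
  · obtain ⟨M, hM⟩ := exists_forall_measure_empiricalFluctuation_le hw hX_meas hX_indep hX_law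
      (ENNReal.ofReal_pos.2 hε)
    obtain ⟨R, n₀, hR⟩ := exists_forall_mul_chiSqDiv_le hp_meas hp_nonneg hp_sum h_full M c
    set B := (∑ j, (mixtureDensity p g₀ j)⁻¹ + 1) ^ 2
    -- R serves n ≥ n₀ and n₀ * B the smaller n. Monotonicity of the outer measure avoids any
    -- measurability of the supremum.
    refine ⟨max R (n₀ * B), fun n => (measure_mono fun ω hω => ?_).trans (hM n)⟩
    simp only [Set.mem_ofPred_eq] at hω ⊢
    intro hz
    refine absurd hω (not_lt.2 (iSup₂_le fun g hg => ENNReal.ofReal_le_ofReal ?_))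
    rcases le_total n₀ n with hn | hn
    · obtain ⟨hpos, hlog⟩ := le_sum_log_of_mem_approxMLESet h_full hc hg
      exact (hR n hn _ hz g hpos hlog).trans (le_max_left _ _)
    · refine le_trans ?_ (le_max_right _ _)
      have := chiSqDiv_le hp_meas hp_nonneg hp_sum h_full g
      have : 0 ≤ chiSqDiv (mixtureDensity p g) (mixtureDensity p g₀) :=
        Finset.sum_nonneg fun k _ => mul_nonneg (sq_nonneg _) (h_full k).le
      gcongr
  · obtain ⟨r, hr, -⟩ := exists_likelihoodRatioStat_eq_coe hp_meas hp_nonneg hp_sum h_full n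
      fun i => X i ω
    rw [hr]
    exact ⟨EReal.coe_ne_bot r, EReal.coe_ne_top r⟩
  · obtain ⟨μ, hμ⟩ :=
      exists_tendstoInDistribution_empiricalFluctuation hw hX_meas hX_indep hX_law
    set φ := quadSup (mixtureDensity p g₀) (⋃ n, localParameterSet p g₀ n)
    have hφc : Continuous φ := continuous_quadSup h_full
      ⟨0, Set.mem_iUnion.2 ⟨0, zero_mem_localParameterSet h_full 0⟩⟩
    have hsub : TendstoInMeasure P
        ((fun (n : ℕ) (ω : Ω) => (likelihoodRatioStat p g₀ n (fun i => X i ω)).toReal)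
          - fun n => φ ∘ fun ω => empiricalFluctuation (mixtureDensity p g₀) n fun i => X i ω)
        atTop 0 := by
      rw [tendstoInMeasure_iff_dist]
      intro ε hε
      rw [ENNReal.tendsto_nhds_zero]
      intro δ hδ
      obtain ⟨M, hM⟩ :=
        exists_forall_measure_empiricalFluctuation_le hw hX_meas hX_indep hX_law hδ
      obtain ⟨n₀, hn₀⟩ := exists_forall_abs_likelihoodRatioStat_sub_le hp_meas hp_nonneg hp_sum
        h_full M (half_pos hε)
      filter_upwards [eventually_ge_atTop n₀] with n hn
      refine (measure_mono fun ω hω => ?_).trans (hM n)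
      simp only [Set.mem_ofPred_eq] at hω ⊢
      intro hz
      have h1 := hn₀ n hn _ hz
      rw [Pi.zero_apply, dist_zero_right, Real.norm_eq_abs] at hω
      have h2 := hω.trans h1
      linarith
    -- Continuous mapping for φ, then Slutsky's lemma.
    have hlim := tendstoInDistribution_of_tendstoInMeasure_sub _ _ (hμ.continuous_comp hφc) hsub
      fun n => (measurable_likelihoodRatioStat hX_meas n).aemeasurable
    have hφm : AEMeasurable (φ ∘ id) (μ : Measure (EuclideanSpace ℝ (Fin K))) :=
      hφc.measurable.aemeasurable
    have hφp := Measure.isProbabilityMeasure_map hφm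
    let ν : ProbabilityMeasure ℝ := ⟨(μ : Measure (EuclideanSpace ℝ (Fin K))).map (φ ∘ id), hφp⟩
    refine ⟨ν, isTightMeasureSet_singleton,
      ⟨hlim.forall_aemeasurable, aemeasurable_id, ?_⟩⟩
    have := hlim.tendsto
    simpa only [ν, ProbabilityMeasure.coe_mk, Measure.map_id] using this
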